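/- Let $(Y_0,Z_1,A_1,W_1,Y_1,Z_2,A_2,W_2,Y_2)$ be a random vector whose law has a joint density $f$ with respect to a product of $\sigma$-finite reference measures (e.g. Lebesgue or counting measures; $\sum$ and $\int dw$, $\int dz$ below denote integrals against these measures). All marginal and conditional densities are those derived from the given version of $f$. Write $\overline y_1=(y_0,y_1)$, $\overline y_2=(y_0,y_1,y_2)$, $\overline a_2=(a_1,a_2)$, $\overline z_2=(z_1,z_2)$, $\overline w_2=(w_1,w_2)$, and also $\overline y_0=y_0$, $\overline a_1=a_1$, $\overline w_1=w_1$, $\overline z_1=z_1$. For $k=1,2$ let $$T_{\overline a_k,\overline y_{k-1}}\colon L_2\{F(\overline w_k\mid \overline a_k,\overline y_{k-1})\}\to L_2\{F(\overline z_k\mid \overline a_k,\overline y_{k-1})\},\qquad T_{\overline a_k,\overline y_{k-1}}h=E[h(\overline W_k)\mid \overline z_k,\overline a_k,\overline y_{k-1}],$$ be the conditional expectation operator, with singular value decomposition $(\lambda_{\overline a_k,\overline y_{k-1},l},\psi_{\overline a_k,\overline y_{k-1},l},\phi_{\overline a_k,\overline y_{k-1},l})_{l}$ (positive $\lambda$'s,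 $\psi$'s and $\phi$'s orthonormal, $Th=\sum_l\lambda_l\langle\psi_l,h\rangle\phi_l$, with $l$ ranging over a finite or infinite set of natural numbers). Such a decomposition exists under (a), and the validity of the conditions in (c) does not depend on its choice. Let $S$ be a set of values $(y_0,y_1,y_2,a_1,a_2)$ such that $f(y_0,a_1)$, $f(\overline y_1,a_1)$ and $f(\overline y_1,\overline a_2)$ are positive and finite. Consider, for $(y_0,y_1,y_2,a_1,a_2)\in S$, the integral equations $$f(y_2\mid\overline y_1,\overline z_2,\overline a_2)=\sum_{\overline w_2}h_{22}(\overline y_2,\overline w_2,\overline a_2)\,f(\overline w_2\mid\overline y_1,\overline a_2,\overline z_2),\tag{1}$$ $$g_{h_{22}}(z_1):=\sum_{\overline w_2}h_{22}(\overline y_2,\overline w_2,\overline a_2)\,f(\overline w_2\mid\overline y_1,a_1,z_1)\,f(y_1\mid y_0,a_1,z_1)=\sum_{w_1}h_{21}(\overline y_2,w_1,\overline a_2)\,f(w_1\mid y_0,a_1,z_1),\tag{2}$$ required for $F(\overline z_2\mid\overline a_2,\overline y_1)$-almost every $\overline z_2$ and $F(z_1\mid a_1,y_0)$-almost every $z_1$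 respectively, with the sums converging absolutely and the functions measurable in $\overline w_2$, resp. $w_1$. Consider the following conditions at every point of $S$. (a) $\sum_{k=1}^2\iint f(\overline w_k\mid\overline z_k,\overline a_k,\overline y_{k-1})\,f(\overline z_k\mid\overline w_k,\overline a_k,\overline y_{k-1})\,d\overline w_k\,d\overline z_k<\infty$. (b1) $\int f^2(y_2\mid\overline z_2,\overline a_2,\overline y_1)\,f(\overline z_2\mid\overline a_2,\overline y_1)\,d\overline z_2<\infty$. (b2) $g_{h_{22}}$ is well defined (the sum over $\overline w_2$ converges absolutely for almost every $z_1$) and $\int g_{h_{22}}(z_1)^2\,f(z_1\mid a_1,y_0)\,dz_1<\infty$. (c1) $\sum_l\lambda_{\overline a_2,\overline y_1,l}^{-2}\,\langle f(y_2\mid\overline z_2,\overline a_2,\overline y_1),\phi_{\overline a_2,\overline y_1,l}\rangle^2<\infty$. (c2) $\sum_l\lambda_{a_1,y_0,l}^{-2}\,\langle g_{h_{22}},\phi_{a_1,y_0,l}\rangle^2<\infty$. (d) For every square integrable $g_1$, $E[g_1(\overline Z_2)\mid\overline y_1,\overline w_2,\overline a_2]=0$ implies $g_1(\overline Z_2)=0$,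 and for every square integrable $g_0$, $E[g_0(Z_1)\mid y_0,w_1,a_1]=0$ implies $g_0(Z_1)=0$ (almost surely, under the conditional laws given $(\overline y_1,\overline a_2)$ and $(y_0,a_1)$ respectively). Assume (a), (b1), (c1) and (d). Then there is a function $h_{22}$ that satisfies (1) on $S$, with $h_{22}(\overline y_2,\cdot,\overline a_2)\in L_2\{F(\overline w_2\mid\overline a_2,\overline y_1)\}$. Moreover, for every solution $h_{22}$ of (1) on $S$ that satisfies (b2) and (c2), there is a function $h_{21}$ such that $(h_{22},h_{21})$ satisfies (2) on $S$, with $h_{21}(\overline y_2,\cdot,\overline a_2)\in L_2\{F(w_1\mid a_1,y_0)\}$. -/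

import Mathlib

open MeasureTheory Filter
open scoped ENNReal

noncomputable section

/-- A singular value decomposition of a bounded operator `T` between real Hilbert spaces, indexed
by a (finite or infinite) set `I` of natural numbers: positive numbers `σ l` and orthonormal systems
`ψ`, `φ` with `T h = ∑ σ l ⟪ψ l, h⟫ φ l` for all `h`. -/
structure IsSingularSystem {E F : Type*} [NormedAddCommGroup E] [InnerProductSpace ℝ E]
    [NormedAddCommGroup F] [InnerProductSpace ℝ F] (T : E →L[ℝ] F) {I : Set ℕ}
    (σ : I → ℝ) (ψ : I → E) (φ : I → F) : Prop where
  pos : ∀ l, 0 < σ l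
  orthonormal_left : Orthonormal ℝ ψ
  orthonormal_right : Orthonormal ℝ φ
  hasSum : ∀ h, HasSum (fun l => (σ l * inner ℝ (ψ l) h) • φ l) (T h)

/-- A joint (unnormalised) density `r w z`, with respect to `μ ⊗ ν`. -/
structure PairDensity {W Z : Type*} [MeasurableSpace W] [MeasurableSpace Z]
    (μ : Measure W) (ν : Measure Z) where
  r : W → Z → ℝ≥0∞
  measurable_r : Measurable (Function.uncurry r)

theorem hasSum_inner_orthonormal {E : Type*} [NormedAddCommGroup E] [InnerProductSpace ℝ E]
    {I : Set ℕ} {e : I → E} (he : Orthonormal ℝ e) {c : I → ℝ} {x : E}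
    (hx : HasSum (fun l => c l • e l) x) (l : I) : inner ℝ (e l) x = c l := by
  classical
  have h1 : HasSum (fun m => inner ℝ (e l) (c m • e m)) (inner ℝ (e l) x) :=
    hx.mapL (innerSL ℝ (e l))
  simp only [inner_smul_right, orthonormal_iff_ite.1 he] at h1
  refine h1.unique ?_
  convert hasSum_single l ?_ using 1
  · rw [if_pos rfl, mul_one]
  · intro m hm
    rw [if_neg hm.symm, mul_zero]

theorem IsSingularSystem.apply_left {E F : Type*} [NormedAddCommGroup E] [InnerProductSpace ℝ E]
    [NormedAddCommGroup F] [InnerProductSpace ℝ F] {T : E →L[ℝ] F} {I : Set ℕ}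
    {σ : I → ℝ} {ψ : I → E} {φ : I → F} (hs : IsSingularSystem T σ ψ φ) (l : I) :
    T (ψ l) = σ l • φ l := by
  classical
  have h1 := hs.hasSum (ψ l)
  simp only [orthonormal_iff_ite.1 hs.orthonormal_left] at h1
  refine h1.unique ?_
  convert hasSum_single l ?_ using 1
  · rw [if_pos rfl, mul_one]
  · intro m hm
    rw [if_neg hm, mul_zero, zero_smul]

/-- The Picard sum is finite for one singular value decomposition iff it is for any other one. -/
theorem IsSingularSystem.summable_picard {E F : Type*} [NormedAddCommGroup E]
    [InnerProductSpace ℝ E] [CompleteSpace E] [NormedAddCommGroup F] [InnerProductSpace ℝ F]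
    {T : E →L[ℝ] F} {I J : Set ℕ} {σ : I → ℝ} {ψ : I → E} {φ : I → F}
    (hs : IsSingularSystem T σ ψ φ) {σ' : J → ℝ} {ψ' : J → E} {φ' : J → F}
    (hs' : IsSingularSystem T σ' ψ' φ') {g : F}
    (hg : Summable fun l => (σ l ^ 2)⁻¹ * inner ℝ g (φ l) ^ 2) :
    Summable fun l => (σ' l ^ 2)⁻¹ * inner ℝ g (φ' l) ^ 2 := by
  have hV := hs.orthonormal_left.orthogonalFamily
  have hsum : Summable fun l => ((σ l)⁻¹ * inner ℝ g (φ l)) • ψ l := by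
    have := (hV.summable_iff_norm_sq_summable fun l => (σ l)⁻¹ * inner ℝ g (φ l)).2
      (by simpa [mul_pow] using hg)
    simpa using this
  obtain ⟨h, hh⟩ := hsum
  have hφ : ∀ l, inner ℝ (T h) (φ l) = inner ℝ g (φ l) := by
    intro l
    rw [real_inner_comm, hasSum_inner_orthonormal hs.orthonormal_right (hs.hasSum h) l,
      hasSum_inner_orthonormal hs.orthonormal_left hh l, mul_inv_cancel_left₀ (hs.pos l).ne']
  have key : ∀ x, inner ℝ (T h) (T x) = inner ℝ g (T x) := by
    intro x
    have h1 : HasSum (fun l => inner ℝ (T h) ((σ l * inner ℝ (ψ l) x) • φ l))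
        (inner ℝ (T h) (T x)) := (hs.hasSum x).mapL (innerSL ℝ (T h))
    have h2 : HasSum (fun l => inner ℝ g ((σ l * inner ℝ (ψ l) x) • φ l))
        (inner ℝ g (T x)) := (hs.hasSum x).mapL (innerSL ℝ g)
    simp only [inner_smul_right, hφ] at h1 h2
    exact h1.unique h2
  have hb := hs'.orthonormal_left.inner_products_summable h
  refine hb.congr fun l => ?_
  have h1 := key (ψ' l)
  rw [hs'.apply_left, inner_smul_right, inner_smul_right] at h1
  have h2 := mul_left_cancel₀ (hs'.pos l).ne' h1
  rw [← h2, real_inner_comm (φ' l) (T h), hasSum_inner_orthonormal hs'.orthonormal_right (hs'.hasSum h) l,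
    mul_pow, inv_mul_cancel_left₀ (pow_ne_zero 2 (hs'.pos l).ne'), Real.norm_eq_abs, sq_abs]

namespace PairDensity

section

variable {W Z : Type*} [MeasurableSpace W] [MeasurableSpace Z] {μ : Measure W} {ν : Measure Z}

/-- `∫ r(w, z) dw` -/
def margZ (q : PairDensity μ ν) (z : Z) : ℝ≥0∞ := ∫⁻ w, q.r w z ∂μ

/-- `∫ r(w, z) dz` -/
def margW (q : PairDensity μ ν) (w : W) : ℝ≥0∞ := ∫⁻ z, q.r w z ∂ν

/-- `∫∫ r(w, z) dw dz` -/
def mass (q : PairDensity μ ν) : ℝ≥0∞ := ∫⁻ z, q.margZ z ∂ν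

/-- the conditional density `f(w | z)` -/
def condW (q : PairDensity μ ν) (w : W) (z : Z) : ℝ≥0∞ := q.r w z / q.margZ z

/-- the conditional density `f(z | w)` -/
def condZ (q : PairDensity μ ν) (w : W) (z : Z) : ℝ≥0∞ := q.r w z / q.margW w

/-- the law `F(w)`, normalised -/
def lawW (q : PairDensity μ ν) : Measure W := μ.withDensity fun w => q.margW w / q.mass

/-- the law `F(z)`, normalised -/
def lawZ (q : PairDensity μ ν) : Measure Z := ν.withDensity fun z => q.margZ z / q.mass

/-- `E[h(W) | z] = ∫ h(w) f(w | z) dw` -/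
def condMeanW (q : PairDensity μ ν) (h : W → ℝ) (z : Z) : ℝ := ∫ w, h w * (q.condW w z).toReal ∂μ

/-- `E[g(Z) | w] = ∫ g(z) f(z | w) dz` -/
def condMeanZ (q : PairDensity μ ν) (g : Z → ℝ) (w : W) : ℝ := ∫ z, g z * (q.condZ w z).toReal ∂ν

/-- `∫∫ f(w | z) f(z | w) dw dz` -/
def hilbertSchmidtIntegral (q : PairDensity μ ν) : ℝ≥0∞ :=
  ∫⁻ w, ∫⁻ z, q.condW w z * q.condZ w z ∂ν ∂μ

/-- For square integrable `g`, `E[g(Z) | W] = 0` implies `g(Z) = 0` (almost surely). -/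
def ZComplete (q : PairDensity μ ν) : Prop :=
  ∀ g : Z → ℝ, MemLp g 2 q.lawZ → (∀ᵐ w ∂q.lawW, q.condMeanZ g w = 0) → g =ᵐ[q.lawZ] 0

theorem measurable_margZ [SigmaFinite μ] (q : PairDensity μ ν) : Measurable q.margZ :=
  q.measurable_r.lintegral_prod_left'

theorem measurable_margW [SigmaFinite ν] (q : PairDensity μ ν) : Measurable q.margW :=
  q.measurable_r.lintegral_prod_right'

theorem measurable_condW [SigmaFinite μ] (q : PairDensity μ ν) :
    Measurable fun p : W × Z => q.condW p.1 p.2 :=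
  q.measurable_r.div (q.measurable_margZ.comp measurable_snd)

variable [SigmaFinite μ] [SigmaFinite ν]

theorem lintegral_condW_le (q : PairDensity μ ν) {G : W → ℝ≥0∞} (hG : Measurable G) :
    ∫⁻ z, ∫⁻ w, G w * q.condW w z ∂μ ∂q.lawZ ≤ ∫⁻ w, G w ∂q.lawW := by
  have hm := q.measurable_condW
  have hr := q.measurable_r
  have h1 : Measurable fun z => ∫⁻ w, G w * q.condW w z ∂μ :=
    Measurable.lintegral_prod_left' (f := fun p : W × Z => G p.1 * q.condW p.1 p.2)
      ((hG.comp measurable_fst).mul hm)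
  rw [lawZ, lintegral_withDensity_eq_lintegral_mul _ (q.measurable_margZ.div_const _) h1, lawW,
    lintegral_withDensity_eq_lintegral_mul _ (q.measurable_margW.div_const _) hG]
  calc _ = ∫⁻ z, ∫⁻ w, (q.margZ z / q.mass) * (G w * q.condW w z) ∂μ ∂ν := by
        refine lintegral_congr fun z => ?_
        simp only [Pi.mul_apply]
        rw [lintegral_const_mul]
        exact hG.mul (hm.comp (measurable_id.prodMk measurable_const))
    _ ≤ ∫⁻ z, ∫⁻ w, G w * (q.r w z / q.mass) ∂μ ∂ν := by
        refine lintegral_mono fun z => lintegral_mono fun w => ?_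
        have : q.margZ z / q.mass * (G w * q.condW w z)
            = G w * ((q.margZ z / q.margZ z) * (q.r w z / q.mass)) := by
          simp only [condW, div_eq_mul_inv]; ring
        rw [this]
        gcongr
        exact mul_le_of_le_one_left' ENNReal.div_self_le_one
    _ = ∫⁻ w, ∫⁻ z, G w * (q.r w z / q.mass) ∂ν ∂μ := by
        rw [lintegral_lintegral_swap]
        exact ((hG.comp measurable_snd).mul
          ((hr.comp measurable_swap).div_const _)).aemeasurable
    _ = _ := by
        refine lintegral_congr fun w => ?_
        have hrw : Measurable fun z => q.r w z := hr.comp (measurable_const.prodMk measurable_id)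
        rw [lintegral_const_mul _ (hrw.div_const _)]
        simp only [Pi.mul_apply, div_eq_mul_inv]
        rw [lintegral_mul_const _ hrw, mul_comm]
        rfl

instance (q : PairDensity μ ν) : IsFiniteMeasure q.lawW := by
  refine ⟨?_⟩
  rw [lawW, withDensity_apply _ MeasurableSet.univ, Measure.restrict_univ]
  simp only [div_eq_mul_inv]
  rw [lintegral_mul_const _ q.measurable_margW]
  have : ∫⁻ w, q.margW w ∂μ = q.mass := by
    simp only [margW, mass, margZ]
    rw [lintegral_lintegral_swap]
    exact q.measurable_r.aemeasurable
  rw [this, ← div_eq_mul_inv]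
  exact ENNReal.div_self_le_one.trans_lt ENNReal.one_lt_top

theorem ae_condMeanW_congr (q : PairDensity μ ν) {h h' : W → ℝ} (H : h =ᵐ[q.lawW] h') :
    q.condMeanW h =ᵐ[q.lawZ] q.condMeanW h' := by
  obtain ⟨N, hN, hNm, hN0⟩ := exists_measurable_superset_of_null H
  have hi : Measurable (N.indicator (1 : W → ℝ≥0∞)) := measurable_one.indicator hNm
  have h0 : ∫⁻ z, ∫⁻ w, N.indicator 1 w * q.condW w z ∂μ ∂q.lawZ = 0 := by
    refine le_antisymm ((q.lintegral_condW_le hi).trans ?_) zero_le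
    rw [lintegral_indicator_one hNm, hN0]
  have hJ : Measurable fun p : W × Z => N.indicator (1 : W → ℝ≥0∞) p.1 * q.condW p.1 p.2 :=
    (hi.comp measurable_fst).mul q.measurable_condW
  rw [lintegral_eq_zero_iff hJ.lintegral_prod_left'] at h0
  filter_upwards [h0] with z hz
  have hz' := (lintegral_eq_zero_iff
    (hJ.comp (measurable_id.prodMk (measurable_const (a := z))))).1 hz
  refine integral_congr_ae ?_
  filter_upwards [hz'] with w hw
  by_cases hwN : w ∈ N
  · have : q.condW w z = 0 := by simpa [hwN] using hw
    simp [this]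
  · have : h w = h' w := by
      by_contra hne
      exact hwN (hN hne)
    rw [this]

theorem ae_integrable_condW (q : PairDensity μ ν) {h : W → ℝ} (hm : Measurable h)
    (hi : Integrable h q.lawW) :
    ∀ᵐ z ∂q.lawZ, Integrable (fun w => h w * (q.condW w z).toReal) μ := by
  have hJ : Measurable fun p : W × Z => ‖h p.1‖ₑ * q.condW p.1 p.2 :=
    (hm.enorm.comp measurable_fst).mul q.measurable_condW
  have hlt : ∫⁻ z, ∫⁻ w, ‖h w‖ₑ * q.condW w z ∂μ ∂q.lawZ < ∞ :=
    (q.lintegral_condW_le hm.enorm).trans_lt hi.2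
  filter_upwards [ae_lt_top hJ.lintegral_prod_left' hlt.ne] with z hz
  have hc : Measurable fun w => q.condW w z :=
    q.measurable_condW.comp (measurable_id.prodMk measurable_const)
  refine ⟨(hm.mul hc.ennreal_toReal).aestronglyMeasurable, lt_of_le_of_lt ?_ hz⟩
  refine lintegral_mono fun w => ?_
  rw [enorm_mul]
  gcongr
  rw [Real.enorm_eq_ofReal ENNReal.toReal_nonneg]
  exact ENNReal.ofReal_toReal_le

theorem stronglyMeasurable_condMeanW (q : PairDensity μ ν) {h : W → ℝ} (hm : Measurable h) :
    StronglyMeasurable (q.condMeanW h) := by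
  have : Measurable fun p : W × Z => h p.1 * (q.condW p.1 p.2).toReal :=
    (hm.comp measurable_fst).mul q.measurable_condW.ennreal_toReal
  exact this.stronglyMeasurable.integral_prod_left'

theorem eLpNorm_condMeanW_le (q : PairDensity μ ν) {h : W → ℝ} (hm : Measurable h) :
    eLpNorm (q.condMeanW h) 2 q.lawZ ≤ eLpNorm h 2 q.lawW := by
  rw [eLpNorm_eq_lintegral_rpow_enorm_toReal (by simp) (by simp),
    eLpNorm_eq_lintegral_rpow_enorm_toReal (by simp) (by simp)]
  gcongr
  refine le_trans (lintegral_mono fun z => ?_)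
    (q.lintegral_condW_le (G := fun w => ‖h w‖ₑ ^ (2 : ℝ≥0∞).toReal) (by fun_prop))
  have hc : Measurable fun w => q.condW w z :=
    q.measurable_condW.comp (measurable_id.prodMk measurable_const)
  have h1 : ‖q.condMeanW h z‖ₑ ≤ ∫⁻ w, ‖h w‖ₑ ∂(μ.withDensity fun w => q.condW w z) := by
    rw [lintegral_withDensity_eq_lintegral_mul _ hc hm.enorm]
    refine (enorm_integral_le_lintegral_enorm _).trans (lintegral_mono fun w => ?_)
    rw [enorm_mul, mul_comm]
    simp only [Pi.mul_apply]
    gcongr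
    rw [Real.enorm_eq_ofReal ENNReal.toReal_nonneg]
    exact ENNReal.ofReal_toReal_le
  have hmass : (μ.withDensity fun w => q.condW w z) Set.univ ≤ 1 := by
    rw [withDensity_apply _ MeasurableSet.univ, Measure.restrict_univ]
    simp only [condW, div_eq_mul_inv]
    have hrz : Measurable fun w => q.r w z :=
      q.measurable_r.comp (measurable_id.prodMk measurable_const)
    rw [lintegral_mul_const _ hrz]
    exact ENNReal.div_self_le_one
  have h2 := eLpNorm_le_eLpNorm_mul_rpow_measure_univ (p := 1) (q := 2)
    (μ := μ.withDensity fun w => q.condW w z) (f := h) (by norm_num) hm.aestronglyMeasurable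
  rw [eLpNorm_one_eq_lintegral_enorm,
    eLpNorm_eq_lintegral_rpow_enorm_toReal (by simp) (by simp)] at h2
  have h3 := h1.trans (h2.trans (mul_le_of_le_one_right' (ENNReal.rpow_le_one hmass (by norm_num))))
  rw [lintegral_withDensity_eq_lintegral_mul _ hc (by fun_prop)] at h3
  have h4 := ENNReal.rpow_le_rpow h3 (z := (2 : ℝ≥0∞).toReal) (by simp)
  rw [← ENNReal.rpow_mul] at h4
  simpa [mul_comm] using h4

theorem memLp_condMeanW (q : PairDensity μ ν) {h : W → ℝ} (hm : Measurable h)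
    (hh : MemLp h 2 q.lawW) : MemLp (q.condMeanW h) 2 q.lawZ :=
  ⟨(q.stronglyMeasurable_condMeanW hm).aestronglyMeasurable,
    (q.eLpNorm_condMeanW_le hm).trans_lt hh.2⟩

/-- The conditional expectation operator `L²(F(w)) → L²(F(z))`, `h ↦ E[h(W) | z]`. -/
def condExpOp (q : PairDensity μ ν) : Lp ℝ 2 q.lawW →L[ℝ] Lp ℝ 2 q.lawZ :=
  LinearMap.mkContinuous
    { toFun := fun h =>
        (q.memLp_condMeanW (Lp.stronglyMeasurable h).measurable (Lp.memLp h)).toLp (q.condMeanW h)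
      map_add' := fun h h' => by
        rw [← MemLp.toLp_add, MemLp.toLp_eq_toLp_iff]
        refine (q.ae_condMeanW_congr (Lp.coeFn_add h h')).trans ?_
        filter_upwards [q.ae_integrable_condW (Lp.stronglyMeasurable h).measurable
            ((Lp.memLp h).integrable one_le_two),
          q.ae_integrable_condW (Lp.stronglyMeasurable h').measurable
            ((Lp.memLp h').integrable one_le_two)] with z hz hz'
        simp only [condMeanW, Pi.add_apply, add_mul]
        exact integral_add hz hz'
      map_smul' := fun c h => by
        rw [RingHom.id_apply, ← MemLp.toLp_const_smul, MemLp.toLp_eq_toLp_iff]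
        refine (q.ae_condMeanW_congr (Lp.coeFn_smul c h)).trans (Eventually.of_forall fun z => ?_)
        simp only [condMeanW, Pi.smul_apply, smul_eq_mul, mul_assoc]
        exact integral_const_mul _ _ }
    1 fun h => by
      simp only [LinearMap.coe_mk, AddHom.coe_mk, one_mul]
      rw [Lp.norm_toLp, Lp.norm_def]
      exact ENNReal.toReal_mono (Lp.eLpNorm_ne_top h)
        (q.eLpNorm_condMeanW_le (Lp.stronglyMeasurable h).measurable)

theorem coeFn_condExpOp (q : PairDensity μ ν) (h : Lp ℝ 2 q.lawW) :
    q.condExpOp h =ᵐ[q.lawZ] q.condMeanW h :=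
  MemLp.coeFn_toLp (q.memLp_condMeanW (Lp.stronglyMeasurable h).measurable (Lp.memLp h))

/-- Picard's summability condition `∑ λ_l⁻² ⟨g, φ_l⟩² < ∞` for the conditional expectation operator.
It does not depend on the choice of the singular value decomposition, see
`picardCondition_of_isSingularSystem`. -/
def PicardCondition (q : PairDensity μ ν) (g : Z → ℝ) : Prop :=
  ∀ (I : Set ℕ) (σ : I → ℝ) (ψ : I → Lp ℝ 2 q.lawW) (φ : I → Lp ℝ 2 q.lawZ),
    IsSingularSystem q.condExpOp σ ψ φ →
      Summable fun l => (σ l ^ 2)⁻¹ * (∫ z, g z * φ l z ∂q.lawZ) ^ 2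

theorem picardCondition_of_isSingularSystem (q : PairDensity μ ν) {g : Z → ℝ}
    (hg : MemLp g 2 q.lawZ) {I : Set ℕ} {σ : I → ℝ} {ψ : I → Lp ℝ 2 q.lawW}
    {φ : I → Lp ℝ 2 q.lawZ} (hs : IsSingularSystem q.condExpOp σ ψ φ)
    (hp : Summable fun l => (σ l ^ 2)⁻¹ * (∫ z, g z * φ l z ∂q.lawZ) ^ 2) :
    q.PicardCondition g := by
  have hi : ∀ f : Lp ℝ 2 q.lawZ, ∫ z, g z * f z ∂q.lawZ = inner ℝ (hg.toLp g) f := by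
    intro f
    rw [L2.inner_def]
    refine integral_congr_ae ?_
    filter_upwards [hg.coeFn_toLp] with z hz
    simp [hz, mul_comm]
  intro J σ' ψ' φ' hs'
  simp only [hi] at hp ⊢
  exact hs.summable_picard hs' hp

end

end PairDensity

/-- The law of the observed random vector `(Y₀, Z₁, A₁, W₁, Y₁, Z₂, A₂, W₂, Y₂)`, given by a version
`f` of its joint density (probability mass function) with respect to a product of σ-finite reference
measures (for instance Lebesgue or counting measures). The arguments of `f` are ordered as
`(y₀, y₁, y₂, a₁, a₂, (z₁, z₂), (w₁, w₂))`. -/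
structure ObservedLaw (Y₀ Y₁ Y₂ A₁ A₂ Z₁ Z₂ W₁ W₂ : Type*)
    [MeasurableSpace Y₀] [MeasurableSpace Y₁] [MeasurableSpace Y₂]
    [MeasurableSpace A₁] [MeasurableSpace A₂] [MeasurableSpace Z₁] [MeasurableSpace Z₂]
    [MeasurableSpace W₁] [MeasurableSpace W₂] where
  μY₀ : Measure Y₀
  μY₁ : Measure Y₁
  μY₂ : Measure Y₂
  μA₁ : Measure A₁
  μA₂ : Measure A₂
  μZ₁ : Measure Z₁
  μZ₂ : Measure Z₂
  μW₁ : Measure W₁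
  μW₂ : Measure W₂
  sigmaFinite_Y₀ : SigmaFinite μY₀
  sigmaFinite_Y₁ : SigmaFinite μY₁
  sigmaFinite_Y₂ : SigmaFinite μY₂
  sigmaFinite_A₁ : SigmaFinite μA₁
  sigmaFinite_A₂ : SigmaFinite μA₂
  sigmaFinite_Z₁ : SigmaFinite μZ₁
  sigmaFinite_Z₂ : SigmaFinite μZ₂
  sigmaFinite_W₁ : SigmaFinite μW₁
  sigmaFinite_W₂ : SigmaFinite μW₂
  f : Y₀ × Y₁ × Y₂ × A₁ × A₂ × (Z₁ × Z₂) × (W₁ × W₂) → ℝ≥0∞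
  measurable_f : Measurable f
  lintegral_f : ∫⁻ o, f o ∂(μY₀.prod (μY₁.prod (μY₂.prod (μA₁.prod (μA₂.prod
    ((μZ₁.prod μZ₂).prod (μW₁.prod μW₂))))))) = 1

/-- Fixed values `(y₀, y₁, y₂, a₁, a₂)` of the outcomes and treatments. -/
structure Values (Y₀ Y₁ Y₂ A₁ A₂ : Type*) where
  y₀ : Y₀
  y₁ : Y₁
  y₂ : Y₂
  a₁ : A₁
  a₂ : A₂

namespace ObservedLaw

attribute [instance] sigmaFinite_Y₀ sigmaFinite_Y₁ sigmaFinite_Y₂ sigmaFinite_A₁ sigmaFinite_A₂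
  sigmaFinite_Z₁ sigmaFinite_Z₂ sigmaFinite_W₁ sigmaFinite_W₂

section

variable {Y₀ Y₁ Y₂ A₁ A₂ Z₁ Z₂ W₁ W₂ : Type*}
  [MeasurableSpace Y₀] [MeasurableSpace Y₁] [MeasurableSpace Y₂]
  [MeasurableSpace A₁] [MeasurableSpace A₂] [MeasurableSpace Z₁] [MeasurableSpace Z₂]
  [MeasurableSpace W₁] [MeasurableSpace W₂]
  (M : ObservedLaw Y₀ Y₁ Y₂ A₁ A₂ Z₁ Z₂ W₁ W₂) (v : Values Y₀ Y₁ Y₂ A₁ A₂)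

/-- `(w̄₂, z̄₂) ↦ f(w̄₂, z̄₂, ȳ₁, ā₂)`. Its `condW`, `condZ`, `lawW`, `lawZ`, `mass` are
`f(w̄₂ | z̄₂, ȳ₁, ā₂)`, `f(z̄₂ | w̄₂, ȳ₁, ā₂)`, `F(w̄₂ | ȳ₁, ā₂)`, `F(z̄₂ | ȳ₁, ā₂)`, `f(ȳ₁, ā₂)`. -/
def pair₂ : PairDensity (M.μW₁.prod M.μW₂) (M.μZ₁.prod M.μZ₂) where
  r w z := ∫⁻ y₂, M.f (v.y₀, v.y₁, y₂, v.a₁, v.a₂, z, w) ∂M.μY₂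
  measurable_r := by
    refine Measurable.lintegral_prod_right' (ν := M.μY₂)
      (f := fun p : ((W₁ × W₂) × (Z₁ × Z₂)) × Y₂ => M.f (v.y₀, v.y₁, p.2, v.a₁, v.a₂, p.1.2, p.1.1)) ?_
    exact M.measurable_f.comp (by fun_prop)

/-- `f(y₂, z̄₂, ȳ₁, ā₂)` -/
def densYZ₂ (z : Z₁ × Z₂) : ℝ≥0∞ :=
  ∫⁻ w, M.f (v.y₀, v.y₁, v.y₂, v.a₁, v.a₂, z, w) ∂(M.μW₁.prod M.μW₂)

/-- `f(y₂ | z̄₂, ȳ₁, ā₂)` -/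
def condY₂ (z : Z₁ × Z₂) : ℝ≥0∞ := M.densYZ₂ v z / (M.pair₂ v).margZ z

/-- `f(w̄₂, y₁, y₀, a₁, z₁)`, for an arbitrary value `y₁` -/
def densWYZ₁ (y₁ : Y₁) (w : W₁ × W₂) (z₁ : Z₁) : ℝ≥0∞ :=
  ∫⁻ t : A₂ × Z₂ × Y₂, M.f (v.y₀, y₁, t.2.2, v.a₁, t.1, (z₁, t.2.1), w)
    ∂(M.μA₂.prod (M.μZ₂.prod M.μY₂))

/-- `f(y₁, y₀, a₁, z₁)` -/
def densYZ₁ (z₁ : Z₁) : ℝ≥0∞ := ∫⁻ w, M.densWYZ₁ v v.y₁ w z₁ ∂(M.μW₁.prod M.μW₂)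

/-- `f(ȳ₁, a₁)` -/
def densY₁ : ℝ≥0∞ := ∫⁻ z₁, M.densYZ₁ v z₁ ∂M.μZ₁

/-- `(w₁, z₁) ↦ f(w₁, z₁, y₀, a₁)`. Its `condW`, `condZ`, `lawW`, `lawZ`, `mass` are
`f(w₁ | z₁, y₀, a₁)`, `f(z₁ | w₁, y₀, a₁)`, `F(w₁ | y₀, a₁)`, `F(z₁ | y₀, a₁)`, `f(y₀, a₁)`. -/
def pair₁ : PairDensity M.μW₁ M.μZ₁ where
  r w₁ z₁ := ∫⁻ s : Y₁ × W₂, M.densWYZ₁ v s.1 (w₁, s.2) z₁ ∂(M.μY₁.prod M.μW₂)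
  measurable_r := by
    refine Measurable.lintegral_prod_right' (ν := M.μY₁.prod M.μW₂)
      (f := fun p : (W₁ × Z₁) × (Y₁ × W₂) => M.densWYZ₁ v p.2.1 (p.1.1, p.2.2) p.1.2) ?_
    refine Measurable.lintegral_prod_right' (ν := M.μA₂.prod (M.μZ₂.prod M.μY₂))
      (f := fun p : ((W₁ × Z₁) × (Y₁ × W₂)) × (A₂ × Z₂ × Y₂) =>
        M.f (v.y₀, p.1.2.1, p.2.2.2, v.a₁, p.2.1, (p.1.1.2, p.2.2.1), (p.1.1.1, p.1.2.2))) ?_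
    exact M.measurable_f.comp (by fun_prop)

/-- `f(w̄₂ | ȳ₁, a₁, z₁)` -/
def condW₂ (w : W₁ × W₂) (z₁ : Z₁) : ℝ≥0∞ := M.densWYZ₁ v v.y₁ w z₁ / M.densYZ₁ v z₁

/-- `f(y₁ | y₀, a₁, z₁)` -/
def condY₁ (z₁ : Z₁) : ℝ≥0∞ := M.densYZ₁ v z₁ / (M.pair₁ v).margZ z₁

/-- `∑_{w̄₂} h(w̄₂) f(w̄₂ | ȳ₁, a₁, z₁) f(y₁ | y₀, a₁, z₁)`, as a function of `z₁` -/
def target₂₁ (h : W₁ × W₂ → ℝ) (z₁ : Z₁) : ℝ :=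
  (∫ w, h w * (M.condW₂ v w z₁).toReal ∂(M.μW₁.prod M.μW₂)) * (M.condY₁ v z₁).toReal

/-- The values that are conditioned on, `(y₀, a₁)`, `(ȳ₁, a₁)` and `(ȳ₁, ā₂)`, have positive finite
density. -/
structure Admissible : Prop where
  y₀a₁ : 0 < (M.pair₁ v).mass ∧ (M.pair₁ v).mass < ∞
  y₁a₁ : 0 < M.densY₁ v ∧ M.densY₁ v < ∞
  y₁a₂ : 0 < (M.pair₂ v).mass ∧ (M.pair₂ v).mass < ∞

/-- `h₂₂` solves the first observed integral equation,
`f(y₂ | ȳ₁, z̄₂, ā₂) = ∑_{w̄₂} h₂₂(ȳ₂, w̄₂, ā₂) f(w̄₂ | ȳ₁, ā₂, z̄₂)` for almost every `z̄₂`. -/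
def SolvesFirst (h₂₂ : W₁ × W₂ → ℝ) : Prop :=
  Measurable h₂₂ ∧ ∀ᵐ z ∂(M.pair₂ v).lawZ,
    Integrable (fun w => h₂₂ w * ((M.pair₂ v).condW w z).toReal) (M.μW₁.prod M.μW₂) ∧
    (M.condY₂ v z).toReal = (M.pair₂ v).condMeanW h₂₂ z

/-- `h₂₁` solves the second observed integral equation,
`∑_{w̄₂} h₂₂(ȳ₂, w̄₂, ā₂) f(y₁ | y₀, z₁, a₁) f(w̄₂ | ȳ₁, a₁, z₁)`
`  = ∑_{w₁} h₂₁(ȳ₂, w₁, ā₂) f(w₁ | y₀, a₁, z₁)`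
for almost every `z₁`. -/
def SolvesSecond (h₂₂ : W₁ × W₂ → ℝ) (h₂₁ : W₁ → ℝ) : Prop :=
  Measurable h₂₁ ∧ ∀ᵐ z₁ ∂(M.pair₁ v).lawZ,
    Integrable (fun w => h₂₂ w * (M.condW₂ v w z₁).toReal) (M.μW₁.prod M.μW₂) ∧
    Integrable (fun w => h₂₁ w * ((M.pair₁ v).condW w z₁).toReal) M.μW₁ ∧
    M.target₂₁ v h₂₂ z₁ = (M.pair₁ v).condMeanW h₂₁ z₁

/-- The left side of the second equation is well defined and square integrable,
`∫ (∑_{w̄₂} h₂₂(ȳ₂, w̄₂, ā₂) f(w̄₂ | ȳ₁, a₁, z₁) f(y₁ | y₀, a₁, z₁))² f(z₁ | a₁, y₀) dz₁ < ∞`. -/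
def SquareIntegrableSecond (h₂₂ : W₁ × W₂ → ℝ) : Prop :=
  (∀ᵐ z₁ ∂(M.pair₁ v).lawZ,
    Integrable (fun w => h₂₂ w * (M.condW₂ v w z₁).toReal) (M.μW₁.prod M.μW₂)) ∧
  ∫⁻ z₁, ENNReal.ofReal (M.target₂₁ v h₂₂ z₁ ^ 2) ∂(M.pair₁ v).lawZ < ∞

end

end ObservedLaw

end

/-! At a fixed point of `S`, both integral equations have the form `E[h(W) | z] = g(z)`, that is `T
h = g` with `T = condExpOp` between two L² spaces: `pair₂` with `g` equal to `condY₂`, then `pair₁`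
with `g` equal to `target₂₁`. `exists_condMeanW_eq` settles both at once by Picard's argument.

Against the law `F(w)`, `T` is an integral operator with kernel `f(z | w) / f(z)`, whose squared L²
norm is bounded by the integral in (a). Bessel's inequality for each `z` then bounds the sums `∑ ‖T
e‖ ^ 2` over finite orthonormal sets (`hilbertSchmidtBound_condExpOp`). Such a bound makes `T`
compact, and an eigenbasis of `T* T` yields a singular system
(`HilbertSchmidtBound.exists_isSingularSystem`).

The adjoint of `T` is `u ↦ E[u(Z) | w]`, so completeness (d) says that the adjoint is injective,
hence that `T` has dense range. Picard's condition makes `h = ∑ σ_l⁻¹ ⟨g, φ_l⟩ ψ_l` converge. Then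
`T h` and `g` have the same coefficients along every `φ_l`, so `T h - g` is orthogonal to the range
of `T` and vanishes. -/

/-! ### Hilbert-Schmidt operators, singular systems and Picard's theorem -/

section SingularSystem

variable {E F : Type*} [NormedAddCommGroup E] [InnerProductSpace ℝ E] [CompleteSpace E]
  [NormedAddCommGroup F] [InnerProductSpace ℝ F] [CompleteSpace F] {T : E →L[ℝ] F}

/-- The Hilbert-Schmidt sums `∑ ‖T e‖ ^ 2` over finite orthonormal sets are at most `C`. -/
def HilbertSchmidtBound (T : E →L[ℝ] F) (C : ℝ) : Prop :=
  ∀ s : Finset E, Orthonormal ℝ ((↑) : ↥(s : Set E) → E) → ∑ x ∈ s, ‖T x‖ ^ 2 ≤ C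

-- An orthonormal family is injective, so its finite subfamilies are finite orthonormal sets.
omit [CompleteSpace E] [CompleteSpace F] in
theorem HilbertSchmidtBound.sum_le {C : ℝ} (hT : HilbertSchmidtBound T C) {ι : Type*} {e : ι → E}
    (he : Orthonormal ℝ e) (s : Finset ι) : ∑ i ∈ s, ‖T (e i)‖ ^ 2 ≤ C := by
  classical
  have hinj : Function.Injective e := he.linearIndependent.injective
  have h := hT (s.image e) ?_
  · rwa [Finset.sum_image fun i _ j _ hij => hinj hij] at h
  · rw [orthonormal_subtype_iff_ite]
    intro x hx y hy
    obtain ⟨i, -, rfl⟩ := Finset.mem_image.1 hx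
    obtain ⟨j, -, rfl⟩ := Finset.mem_image.1 hy
    rw [orthonormal_iff_ite.1 he]
    simp [hinj.eq_iff]

omit [CompleteSpace E] [CompleteSpace F] in
/-- Off the span of a nearly optimal finite orthonormal set, `T` is small. -/
theorem HilbertSchmidtBound.norm_sq_le_of_mem_orthogonal {C ε : ℝ} (hT : HilbertSchmidtBound T C)
    {s : Finset E} (hs : Orthonormal ℝ ((↑) : ↥(s : Set E) → E)) (hsC : C - ε ≤ ∑ x ∈ s, ‖T x‖ ^ 2)
    {y : E} (hy : y ∈ (Submodule.span ℝ (s : Set E))ᗮ) : ‖T y‖ ^ 2 ≤ ε * ‖y‖ ^ 2 := by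
  classical
  by_cases hy0 : y = 0
  · simp [hy0]
  have hn : 0 < ‖y‖ := norm_pos_iff.2 hy0
  set u : E := ‖y‖⁻¹ • y with hu
  have hu1 : inner ℝ u u = 1 := by
    rw [real_inner_self_eq_norm_sq, hu, norm_smul, norm_inv, norm_norm, inv_mul_cancel₀ hn.ne',
      one_pow]
  have hxu : ∀ x ∈ s, inner ℝ x u = 0 := fun x hx => by
    rw [hu, inner_smul_right, (Submodule.mem_orthogonal _ _).1 hy x (Submodule.subset_span hx),
      mul_zero]
  have hus : u ∉ s := fun h => by
    have := hxu u h
    rw [hu1] at this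
    exact one_ne_zero this
  -- The sum over `s` already uses all of `C` but `ε`, so one more unit vector can contribute at
  -- most `ε`.
  have h := hT (insert u s) ?_
  · rw [Finset.sum_insert hus] at h
    have h1 : ‖T u‖ ^ 2 ≤ ε := by linarith
    have h2 : ‖T u‖ = ‖y‖⁻¹ * ‖T y‖ := by rw [hu, map_smul, norm_smul, norm_inv, norm_norm]
    rw [h2, mul_pow, inv_pow, inv_mul_le_iff₀ (by positivity)] at h1
    linarith
  · rw [orthonormal_subtype_iff_ite] at hs ⊢
    intro x hx y hy
    rcases Finset.mem_insert.1 hx with rfl | hx <;> rcases Finset.mem_insert.1 hy with rfl | hy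
    · rw [hu1, if_pos rfl]
    · rw [real_inner_comm, hxu y hy, if_neg]
      rintro rfl
      exact hus hy
    · rw [hxu x hx, if_neg]
      rintro rfl
      exact hus hx
    · exact hs x hx y hy

-- `T` is a norm limit of finite rank operators `T ∘ P`, with `P` the projection onto the span of a
-- finite orthonormal set whose sum `∑ ‖T x‖ ^ 2` is nearly maximal.
omit [CompleteSpace E] in
theorem HilbertSchmidtBound.isCompactOperator {C : ℝ} (hT : HilbertSchmidtBound T C) :
    IsCompactOperator T := by
  let A : Set ℝ := {a | ∃ s : Finset E, Orthonormal ℝ ((↑) : ↥(s : Set E) → E) ∧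
    a = ∑ x ∈ s, ‖T x‖ ^ 2}
  have hne : A.Nonempty := ⟨0, ∅, ⟨fun x => absurd x.2 (Finset.notMem_empty _),
    fun x => absurd x.2 (Finset.notMem_empty _)⟩, by simp⟩
  have hbdd : BddAbove A := ⟨C, by rintro _ ⟨s, hs, rfl⟩; exact hT s hs⟩
  -- The constant is lowered to the supremum, which finite orthonormal sets approach within any `(δ
  -- / 2) ^ 2`.
  have hT' : HilbertSchmidtBound T (sSup A) := fun s hs => le_csSup hbdd ⟨s, hs, rfl⟩
  have hcl : IsClosed {f : E →L[ℝ] F | IsCompactOperator f} :=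
    isClosed_setOfPred_isCompactOperator
  refine hcl.closure_subset (Metric.mem_closure_iff.2 fun δ hδ => ?_)
  obtain ⟨_, ⟨s, hs, rfl⟩, hlt⟩ := exists_lt_of_lt_csSup hne
    (show sSup A - (δ / 2) ^ 2 < sSup A by linarith [pow_pos (half_pos hδ) 2])
  let V := Submodule.span ℝ (s : Set E)
  have : FiniteDimensional ℝ V := FiniteDimensional.span_finset ℝ s
  refine ⟨T ∘L V.starProjection, ?_, ?_⟩
  · have h1 : IsCompactOperator (T ∘L V.subtypeL) :=
      isCompactOperator_of_locallyCompactSpace_rng _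
    exact h1.comp_clm V.orthogonalProjectionOnto
  · rw [dist_eq_norm]
    refine lt_of_le_of_lt (ContinuousLinearMap.opNorm_le_bound _ (half_pos hδ).le fun x => ?_)
      (half_lt_self hδ)
    have h1 := hT'.norm_sq_le_of_mem_orthogonal hs hlt.le
      (V.sub_starProjection_mem_orthogonal x)
    have h2 : ‖x - V.starProjection x‖ ≤ ‖x‖ := by
      have := Vᗮ.norm_starProjection_apply_le x
      rwa [Submodule.starProjection_orthogonal_val] at this
    have h3 : ‖T (x - V.starProjection x)‖ ≤ δ / 2 * ‖x - V.starProjection x‖ := by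
      rw [← mul_pow] at h1
      exact le_of_sq_le_sq h1 (by positivity)
    calc _ = ‖T (x - V.starProjection x)‖ := by simp
      _ ≤ _ := h3
      _ ≤ _ := by gcongr

/-- A compact self-adjoint operator has an orthonormal basis of eigenvectors. -/
theorem exists_hilbertBasis_eigenvectors.{u} {E : Type u} [NormedAddCommGroup E]
    [InnerProductSpace ℝ E] [CompleteSpace E] {A : E →L[ℝ] E} (hA : IsCompactOperator A)
    (hA' : (A : E →ₗ[ℝ] E).IsSymmetric) :
    ∃ (ι : Type u) (b : HilbertBasis ι ℝ E) (μ : ι → ℝ), ∀ i, A (b i) = μ i • b i := by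
  let V (μ : ℝ) : Submodule ℝ E := Module.End.eigenspace (A : E →ₗ[ℝ] E) μ
  have hV : ∀ μ x, x ∈ V μ ↔ A x = μ • x := fun μ x => Module.End.mem_eigenspace_iff
  have : ∀ μ, CompleteSpace (V μ) := fun μ => by
    have : IsClosed (V μ : Set E) := by
      have : (V μ : Set E) = {x | A x = μ • x} := Set.ext fun x => hV μ x
      rw [this]
      exact isClosed_eq A.continuous (continuous_const_smul μ)
    exact this.completeSpace_coe
  -- Every real `μ` gets a basis of its eigenspace, empty when `μ` is not an eigenvalue. The case `μ
  -- = 0` supplies the kernel.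
  choose w c hc using fun μ => exists_hilbertBasis ℝ (V μ)
  have ho := hA'.orthogonalFamily_eigenspaces.orthonormal_sigma_orthonormal
    (v_family := fun μ => c μ) fun μ => (c μ).orthonormal
  refine ⟨_, HilbertBasis.mkOfOrthogonalEqBot ho ?_, fun i => i.1, fun i => ?_⟩
  -- A vector orthogonal to all chosen basis vectors is orthogonal to each eigenspace, and the
  -- spectral theorem leaves only zero.
  · rw [eq_bot_iff, ← ContinuousLinearMap.orthogonalComplement_iSup_eigenspaces_eq_bot hA hA']
    intro x hx
    rw [Submodule.mem_orthogonal] at hx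
    rw [← Submodule.iInf_orthogonal, Submodule.mem_iInf]
    refine fun μ => (Submodule.mem_orthogonal _ _).2 fun u hu => ?_
    have h1 := ((c μ).hasSum_repr ⟨u, hu⟩).mapL (V μ).subtypeL
    have h2 := h1.mapL (innerSL ℝ x)
    have h3 : ∀ i, inner ℝ x ((c μ i : V μ) : E) = 0 := fun i => by
      rw [real_inner_comm]
      exact hx _ (Submodule.subset_span ⟨⟨μ, i⟩, rfl⟩)
    rw [real_inner_comm]
    refine h2.unique ?_
    simp [h3, hasSum_zero]
  · rw [HilbertBasis.coe_mkOfOrthogonalEqBot]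
    exact (hV _ _).1 (c i.1 i.2).2

/-- For an eigenbasis `b` of `T* T`, the images are orthogonal because `⟨T b_i, T b_j⟩ = ⟨T* T b_i,
b_j⟩ = μ_i ⟨b_i, b_j⟩`. Normalising the nonzero images gives `φ`, with `σ` their norms and `ψ` the
corresponding `b_i`. -/
theorem HilbertSchmidtBound.exists_isSingularSystem {C : ℝ} (hT : HilbertSchmidtBound T C) :
    ∃ (I : Set ℕ) (σ : I → ℝ) (ψ : I → E) (φ : I → F), IsSingularSystem T σ ψ φ := by
  obtain ⟨ι, b, μ, hb⟩ := exists_hilbertBasis_eigenvectors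
    (A := T.adjoint ∘L T) (hT.isCompactOperator.clm_comp T.adjoint)
    (fun x y => by
      simp [ContinuousLinearMap.adjoint_inner_left, ContinuousLinearMap.adjoint_inner_right])
  have hsum : Summable fun i => ‖T (b i)‖ ^ 2 :=
    summable_of_sum_le (fun i => by positivity) fun s => hT.sum_le b.orthonormal s
  -- The basis itself may be uncountable. Only the vectors with nonzero image are indexed, and
  -- square summability makes these countable.
  have hcount : {i | T (b i) ≠ 0}.Countable := by
    refine hsum.countable_support.mono fun i hi => ?_
    simpa using hi
  have horth : ∀ i j, i ≠ j → inner ℝ (T (b i)) (T (b j)) = 0 := fun i j hij => by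
    rw [← ContinuousLinearMap.adjoint_inner_left]
    have := hb i
    rw [ContinuousLinearMap.comp_apply] at this
    rw [this, inner_smul_left, b.orthonormal.2 hij, mul_zero]
  have : Countable {i // T (b i) ≠ 0} := Set.countable_coe_iff.2 hcount
  obtain ⟨g, hg⟩ := Countable.exists_injective_nat {i // T (b i) ≠ 0}
  let r : Set.range g ≃ {i // T (b i) ≠ 0} := (Equiv.ofInjective g hg).symm
  refine ⟨Set.range g, fun l => ‖T (b (r l))‖, fun l => b (r l),
    fun l => ‖T (b (r l))‖⁻¹ • T (b (r l)), fun l => norm_pos_iff.2 (r l).2,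
    b.orthonormal.comp _ (Subtype.val_injective.comp r.injective), ⟨fun l => ?_, fun l m hlm => ?_⟩,
    fun h => ?_⟩
  · rw [norm_smul, norm_inv, norm_norm, inv_mul_cancel₀ (norm_pos_iff.2 (r l).2).ne']
  · simp only [inner_smul_left, inner_smul_right]
    rw [horth, mul_zero, mul_zero]
    exact fun h => hlm (r.injective (Subtype.ext h))
  · have h1 := (b.hasSum_repr h).mapL T
    have h2 : HasSum (fun i : {i // T (b i) ≠ 0} => T (b.repr h i • b i)) (T h) := by
      refine (hasSum_subtype_iff_of_support_subset fun i hi => ?_).2 h1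
      intro h0
      simp [h0] at hi
    have h3 := (r.hasSum_iff).2 h2
    convert h3 using 1
    ext l
    have : ‖T (b (r l))‖ ≠ 0 := norm_ne_zero_iff.2 (r l).2
    simp only [Function.comp_apply, map_smul, b.repr_apply_apply, smul_smul]
    congr 1
    field_simp

omit [CompleteSpace F] in
/-- Picard's theorem for an operator of dense range. -/
theorem IsSingularSystem.exists_apply_eq {I : Set ℕ} {σ : I → ℝ} {ψ : I → E} {φ : I → F}
    (hs : IsSingularSystem T σ ψ φ) (hT : ∀ u : F, (∀ h, inner ℝ u (T h) = 0) → u = 0) {g : F}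
    (hg : Summable fun l => (σ l ^ 2)⁻¹ * inner ℝ g (φ l) ^ 2) : ∃ h, T h = g := by
  have hsum : Summable fun l => ((σ l)⁻¹ * inner ℝ g (φ l)) • ψ l := by
    have := (hs.orthonormal_left.orthogonalFamily.summable_iff_norm_sq_summable
      fun l => (σ l)⁻¹ * inner ℝ g (φ l)).2 (by simpa [mul_pow] using hg)
    simpa using this
  obtain ⟨h, hh⟩ := hsum
  -- Each `T x` is a series in the `φ_l`, and `T h - g` is orthogonal to every `φ_l`.
  refine ⟨h, sub_eq_zero.1 (hT _ fun x => ?_)⟩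
  have h0 := (hs.hasSum x).mapL (innerSL ℝ (T h - g))
  have hz : (fun l => innerSL ℝ (T h - g) ((σ l * inner ℝ (ψ l) x) • φ l)) = fun _ => 0 := by
    ext l
    rw [innerSL_apply_apply, inner_smul_right, inner_sub_left, real_inner_comm (φ l) (T h),
      hasSum_inner_orthonormal hs.orthonormal_right (hs.hasSum h) l,
      hasSum_inner_orthonormal hs.orthonormal_left hh l, mul_inv_cancel_left₀ (hs.pos l).ne',
      sub_self, mul_zero]
  rw [hz] at h0
  exact h0.unique hasSum_zero

end SingularSystem

/-! ### The conditional expectation operator as a Hilbert-Schmidt integral operator -/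

theorem ofReal_norm_sq_eq_lintegral {α : Type*} [MeasurableSpace α] {m : Measure α}
    (f : Lp ℝ 2 m) : ENNReal.ofReal (‖f‖ ^ 2) = ∫⁻ x, ‖f x‖ₑ ^ 2 ∂m := by
  have h := eLpNorm_nnreal_pow_eq_lintegral (μ := m) (f := f) (p := 2) two_ne_zero
  rw [ENNReal.ofReal_pow (norm_nonneg _), ofReal_norm, Lp.enorm_def]
  simpa using h

namespace PairDensity

variable {W Z : Type*} [MeasurableSpace W] [MeasurableSpace Z] {μ : Measure W} {ν : Measure Z}

/-- The density with the roles of `w` and `z` exchanged. -/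
noncomputable def swap (q : PairDensity μ ν) : PairDensity ν μ where
  r z w := q.r w z
  measurable_r := q.measurable_r.comp measurable_swap

/-- The kernel of the conditional expectation operator with respect to the law `F(w)`,
`f(z | w) / f(z)`. -/
noncomputable def kernel (q : PairDensity μ ν) (z : Z) (w : W) : ℝ≥0∞ :=
  q.condZ w z * q.mass / q.margZ z

variable [SigmaFinite μ] [SigmaFinite ν]

theorem mass_swap (q : PairDensity μ ν) : q.swap.mass = q.mass := by
  simp only [mass, margZ, swap]
  rw [lintegral_lintegral_swap]
  exact q.measurable_r.aemeasurable

theorem lawZ_swap (q : PairDensity μ ν) : q.swap.lawZ = q.lawW := by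
  rw [lawZ, lawW, mass_swap]
  rfl

theorem lawW_swap (q : PairDensity μ ν) : q.swap.lawW = q.lawZ := by
  rw [lawZ, lawW, mass_swap]
  rfl

omit [SigmaFinite μ] in
theorem measurable_condZ (q : PairDensity μ ν) : Measurable fun p : W × Z => q.condZ p.1 p.2 :=
  q.measurable_r.div (q.measurable_margW.comp measurable_fst)

theorem measurable_kernel (q : PairDensity μ ν) : Measurable fun p : Z × W => q.kernel p.1 p.2 :=
  ((q.measurable_condZ.comp measurable_swap).mul_const _).div
    (q.measurable_margZ.comp measurable_fst)

omit [SigmaFinite ν] in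
theorem ae_margZ_lt_top (q : PairDensity μ ν) (hm : q.mass ≠ ∞) : ∀ᵐ z ∂ν, q.margZ z < ∞ :=
  ae_lt_top q.measurable_margZ hm

theorem ae_margW_lt_top (q : PairDensity μ ν) (hm : q.mass ≠ ∞) : ∀ᵐ w ∂μ, q.margW w < ∞ :=
  q.swap.ae_margZ_lt_top (by rwa [mass_swap])

-- With division in `ℝ≥0∞`, multiplying back is safe unless the marginal is `0` or `∞`. The value
-- `∞` has measure zero since the mass is finite; where the marginal is `0`, the density vanishes
-- for almost every `w`.
omit [SigmaFinite ν] in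
theorem ae_eq_condW_mul_margZ (q : PairDensity μ ν) (hm : q.mass ≠ ∞) :
    ∀ᵐ z ∂ν, ∀ᵐ w ∂μ, q.r w z = q.condW w z * q.margZ z := by
  filter_upwards [q.ae_margZ_lt_top hm] with z hz
  by_cases h0 : q.margZ z = 0
  · have hr : Measurable fun w => q.r w z :=
      q.measurable_r.comp (measurable_id.prodMk measurable_const)
    filter_upwards [(lintegral_eq_zero_iff hr).1 h0] with w hw
    rw [h0, mul_zero]
    exact hw
  · exact Eventually.of_forall fun w => (ENNReal.div_mul_cancel h0 hz.ne).symm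

theorem ae_eq_condZ_mul_margW (q : PairDensity μ ν) (hm : q.mass ≠ ∞) :
    ∀ᵐ z ∂ν, ∀ᵐ w ∂μ, q.r w z = q.condZ w z * q.margW w := by
  have h := q.swap.ae_eq_condW_mul_margZ (by rwa [mass_swap])
  -- The exchanged density gives the quantifiers in the order `w`, then `z`; measurability of the
  -- set allows reversing them.
  refine (Measure.ae_ae_comm (p := fun w z => q.r w z = q.condZ w z * q.margW w) ?_).1 h
  exact measurableSet_eq_fun q.measurable_r
    (q.measurable_condZ.mul (q.measurable_margW.comp measurable_fst))

theorem ae_condW_eq_mul_kernel (q : PairDensity μ ν) (h0 : q.mass ≠ 0) (hm : q.mass ≠ ∞) :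
    ∀ᵐ z ∂ν, ∀ᵐ w ∂μ, q.condW w z = q.margW w / q.mass * q.kernel z w := by
  filter_upwards [q.ae_eq_condZ_mul_margW hm] with z hz
  filter_upwards [hz] with w hw
  have : q.margW w / q.mass * q.kernel z w
      = q.mass * (q.mass)⁻¹ * (q.condZ w z * q.margW w / q.margZ z) := by
    simp only [kernel, div_eq_mul_inv]
    ring
  rw [this, ENNReal.mul_inv_cancel h0 hm, one_mul, ← hw, condW]

/-- The conditional mean is an integral against the kernel. -/
theorem ae_condMeanW_eq_integral_kernel (q : PairDensity μ ν) (h0 : q.mass ≠ 0)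
    (hm : q.mass ≠ ∞) :
    ∀ᵐ z ∂ν, ∀ h : W → ℝ, q.condMeanW h z = ∫ w, h w * (q.kernel z w).toReal ∂q.lawW := by
  filter_upwards [q.ae_condW_eq_mul_kernel h0 hm] with z hz h
  rw [lawW, integral_withDensity_eq_integral_toReal_smul (q.measurable_margW.div_const _)]
  · refine integral_congr_ae ?_
    filter_upwards [hz] with w hw
    rw [hw, ENNReal.toReal_mul, smul_eq_mul]
    ring
  · filter_upwards [q.ae_margW_lt_top hm] with w hw
    exact ENNReal.div_lt_top hw.ne h0

/-- One kernel factor turns `F(dw)` into `f(w | z) dw`, and in the other the density of `F(dz)`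
cancels, leaving `f(w | z) f(z | w)`. Only an inequality is claimed because `x / x` may be `0` in
`ℝ≥0∞`. -/
theorem lintegral_kernel_sq_le (q : PairDensity μ ν) (h0 : q.mass ≠ 0) (hm : q.mass ≠ ∞) :
    ∫⁻ z, ∫⁻ w, q.kernel z w ^ 2 ∂q.lawW ∂q.lawZ ≤ q.hilbertSchmidtIntegral := by
  have hk := q.measurable_kernel
  have hkz : ∀ z, Measurable fun w => q.kernel z w := fun z =>
    hk.comp (measurable_const.prodMk measurable_id)
  have hc := q.measurable_condW
  have h1 : Measurable fun z => ∫⁻ w, q.kernel z w ^ 2 ∂q.lawW :=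
    (hk.pow_const 2).lintegral_prod_right'
  rw [lawZ, lintegral_withDensity_eq_lintegral_mul _ (q.measurable_margZ.div_const _) h1]
  calc _ ≤ ∫⁻ z, ∫⁻ w, q.condW w z * q.condZ w z ∂μ ∂ν := by
        refine lintegral_mono_ae ?_
        filter_upwards [q.ae_condW_eq_mul_kernel h0 hm] with z hz
        rw [Pi.mul_apply, lawW, lintegral_withDensity_eq_lintegral_mul _
          (q.measurable_margW.div_const _) ((hkz z).pow_const 2), ← lintegral_const_mul _
          ((q.measurable_margW.div_const _).mul ((hkz z).pow_const 2))]
        refine lintegral_mono_ae ?_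
        filter_upwards [hz] with w hw
        calc _ = q.margZ z / q.mass * (q.condW w z * q.kernel z w) := by
              rw [hw, Pi.mul_apply]; ring
          _ = q.condW w z * q.condZ w z * (q.margZ z / q.margZ z) * (q.mass / q.mass) := by
              simp only [kernel, div_eq_mul_inv]; ring
          _ ≤ q.condW w z * q.condZ w z * 1 * 1 := by
              gcongr <;> exact ENNReal.div_self_le_one
          _ = _ := by simp
    _ = _ := by
        rw [hilbertSchmidtIntegral, lintegral_lintegral_swap]
        exact ((hc.comp measurable_swap).mul
          (q.measurable_condZ.comp measurable_swap)).aemeasurable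

omit [SigmaFinite μ] [SigmaFinite ν] in
theorem lawZ_absolutelyContinuous (q : PairDensity μ ν) : q.lawZ ≪ ν :=
  withDensity_absolutelyContinuous _ _

/-- For almost every `z`, `(T f)(z)` is the inner product of `f` with `kernel z`. Bessel's
inequality bounds the sum of squares over an orthonormal set by the squared norm of `kernel z`,
which is then integrated in `z`. -/
theorem hilbertSchmidtBound_condExpOp (q : PairDensity μ ν) (h0 : q.mass ≠ 0) (hm : q.mass ≠ ∞)
    (hHS : q.hilbertSchmidtIntegral ≠ ∞) :
    HilbertSchmidtBound q.condExpOp q.hilbertSchmidtIntegral.toReal := by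
  intro s hs
  have hk := q.measurable_kernel
  have key : ∀ᵐ z ∂q.lawZ, ∑ f ∈ s, ‖q.condExpOp f z‖ₑ ^ 2 ≤ ∫⁻ w, q.kernel z w ^ 2 ∂q.lawW := by
    have hae : ∀ᵐ z ∂q.lawZ, ∀ f ∈ s, q.condExpOp f z = q.condMeanW f z :=
      (ae_ball_iff s.countable_toSet).2 fun f _ => q.coeFn_condExpOp f
    filter_upwards [hae, q.lawZ_absolutelyContinuous.ae_le
      (q.ae_condMeanW_eq_integral_kernel h0 hm)] with z hz hz'
    -- Where the kernel is not square integrable the bound is `∞`; elsewhere it defines an element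
    -- of L².
    by_cases htop : ∫⁻ w, q.kernel z w ^ 2 ∂q.lawW = ∞
    · simp [htop]
    have hkz : Measurable fun w => q.kernel z w := hk.comp (measurable_const.prodMk measurable_id)
    have hle : ∫⁻ w, ‖(q.kernel z w).toReal‖ₑ ^ 2 ∂q.lawW ≤ ∫⁻ w, q.kernel z w ^ 2 ∂q.lawW := by
      gcongr with w
      rw [Real.enorm_eq_ofReal ENNReal.toReal_nonneg]
      exact ENNReal.ofReal_toReal_le
    have hmem : MemLp (fun w => (q.kernel z w).toReal) 2 q.lawW := by
      refine ⟨hkz.ennreal_toReal.aestronglyMeasurable, ?_⟩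
      rw [eLpNorm_lt_top_iff_lintegral_rpow_enorm_lt_top two_ne_zero ENNReal.ofNat_ne_top]
      simpa using hle.trans_lt (lt_top_iff_ne_top.2 htop)
    have hin : ∀ f ∈ s, q.condExpOp f z = inner ℝ f (hmem.toLp _) := fun f hf => by
      rw [hz f hf, hz', L2.inner_def]
      refine integral_congr_ae ?_
      filter_upwards [hmem.coeFn_toLp] with w hw
      simp [hw, mul_comm]
    have hB := hs.sum_inner_products_le (hmem.toLp _) (s := s.attach)
    calc ∑ f ∈ s, ‖q.condExpOp f z‖ₑ ^ 2
        = ENNReal.ofReal (∑ f ∈ s.attach, ‖inner ℝ (f : Lp ℝ 2 q.lawW) (hmem.toLp _)‖ ^ 2) := by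
          rw [ENNReal.ofReal_sum_of_nonneg fun _ _ => by positivity, ← Finset.sum_attach]
          refine Finset.sum_congr rfl fun f _ => ?_
          rw [hin f f.2, ENNReal.ofReal_pow (norm_nonneg _), ofReal_norm]
      _ ≤ ENNReal.ofReal (‖hmem.toLp _‖ ^ 2) := ENNReal.ofReal_le_ofReal hB
      _ = ∫⁻ w, ‖(q.kernel z w).toReal‖ₑ ^ 2 ∂q.lawW := by
          rw [ofReal_norm_sq_eq_lintegral]
          refine lintegral_congr_ae ?_
          filter_upwards [hmem.coeFn_toLp] with w hw
          rw [hw]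
      _ ≤ _ := hle
  rw [← ENNReal.ofReal_le_iff_le_toReal hHS,
    ENNReal.ofReal_sum_of_nonneg fun _ _ => by positivity]
  simp only [ofReal_norm_sq_eq_lintegral]
  rw [← lintegral_finsetSum' _ fun f _ =>
    ((Lp.aestronglyMeasurable (q.condExpOp f)).enorm.pow_const 2)]
  exact (lintegral_mono_ae key).trans (q.lintegral_kernel_sq_le h0 hm)

/-! ### The adjoint of conditional expectation, completeness and solvability -/

/-- The joint law of `(W, Z)`. -/
noncomputable def jointLaw (q : PairDensity μ ν) : Measure (W × Z) :=
  (μ.prod ν).withDensity fun p => q.r p.1 p.2 / q.mass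

theorem measurePreserving_fst_jointLaw (q : PairDensity μ ν) :
    MeasurePreserving Prod.fst q.jointLaw q.lawW := by
  refine ⟨measurable_fst, Measure.ext fun A hA => ?_⟩
  have hr : Measurable fun p : W × Z => q.r p.1 p.2 / q.mass := q.measurable_r.div_const _
  rw [Measure.map_apply measurable_fst hA, jointLaw, withDensity_apply _ (measurable_fst hA), lawW,
    withDensity_apply _ hA, ← Set.prod_univ, ← Measure.prod_restrict, Measure.restrict_univ,
    lintegral_prod _ hr.aemeasurable]
  refine lintegral_congr fun w => ?_
  simp only [div_eq_mul_inv]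
  have hrw : Measurable fun z => q.r w z :=
    q.measurable_r.comp (measurable_const.prodMk measurable_id)
  rw [lintegral_mul_const _ hrw]
  rfl

theorem measurePreserving_snd_jointLaw (q : PairDensity μ ν) :
    MeasurePreserving Prod.snd q.jointLaw q.lawZ := by
  refine ⟨measurable_snd, Measure.ext fun A hA => ?_⟩
  have hr : Measurable fun p : W × Z => q.r p.1 p.2 / q.mass := q.measurable_r.div_const _
  rw [Measure.map_apply measurable_snd hA, jointLaw, withDensity_apply _ (measurable_snd hA), lawZ,
    withDensity_apply _ hA, ← Set.univ_prod, ← Measure.prod_restrict, Measure.restrict_univ,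
    lintegral_prod_symm _ hr.aemeasurable]
  refine lintegral_congr fun z => ?_
  simp only [div_eq_mul_inv]
  have hrz : Measurable fun w => q.r w z :=
    q.measurable_r.comp (measurable_id.prodMk measurable_const)
  rw [lintegral_mul_const _ hrz]
  rfl

/-- Under the joint law, whose marginals are `lawW` and `lawZ`, both factors are square integrable,
so their product is integrable. This licenses Fubini for the adjoint identity. -/
theorem integrable_mul_joint (q : PairDensity μ ν) (h0 : q.mass ≠ 0) (hm : q.mass ≠ ∞)
    {u : Z → ℝ} {h : W → ℝ} (hu : MemLp u 2 q.lawZ) (hh : MemLp h 2 q.lawW) :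
    Integrable (fun p : W × Z => u p.2 * h p.1 * (q.r p.1 p.2 / q.mass).toReal) (μ.prod ν) := by
  have h1 : Integrable (fun p : W × Z => u p.2 * h p.1) q.jointLaw :=
    (hu.comp_measurePreserving q.measurePreserving_snd_jointLaw).integrable_mul
      (hh.comp_measurePreserving q.measurePreserving_fst_jointLaw)
  have hr : Measurable fun p : W × Z => q.r p.1 p.2 / q.mass := q.measurable_r.div_const _
  have hlt : ∀ᵐ p ∂μ.prod ν, q.r p.1 p.2 / q.mass < ∞ := by
    have : ∀ᵐ p ∂μ.prod ν, q.r p.1 p.2 < ∞ := by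
      refine ae_lt_top q.measurable_r ?_
      exact (lintegral_prod_symm _ q.measurable_r.aemeasurable).trans_ne hm
    filter_upwards [this] with p hp
    exact ENNReal.div_lt_top hp.ne h0
  rw [jointLaw, integrable_withDensity_iff_integrable_smul' hr hlt] at h1
  simpa [mul_comm] using h1

-- The order of integration is kept, so `u` and `h` can be arbitrary functions; it is applied to the
-- exchanged density as well.
omit [SigmaFinite ν] in
theorem integral_mul_condMeanW (q : PairDensity μ ν) (h0 : q.mass ≠ 0) (hm : q.mass ≠ ∞)
    (u : Z → ℝ) (h : W → ℝ) :
    ∫ z, u z * q.condMeanW h z ∂q.lawZ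
      = ∫ z, ∫ w, u z * h w * (q.r w z / q.mass).toReal ∂μ ∂ν := by
  rw [lawZ, integral_withDensity_eq_integral_toReal_smul (q.measurable_margZ.div_const _)]
  · refine integral_congr_ae ?_
    filter_upwards [q.ae_eq_condW_mul_margZ hm] with z hz
    rw [condMeanW, smul_eq_mul, ← mul_assoc, ← integral_const_mul]
    refine integral_congr_ae ?_
    filter_upwards [hz] with w hw
    rw [hw, mul_div_assoc, ENNReal.toReal_mul]
    ring
  · filter_upwards [q.ae_margZ_lt_top hm] with z hz
    exact ENNReal.div_lt_top hz.ne h0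

/-- The conditional means given `z` and given `w` are adjoint to each other. -/
theorem integral_condMeanW_eq_integral_condMeanZ (q : PairDensity μ ν) (h0 : q.mass ≠ 0)
    (hm : q.mass ≠ ∞) {u : Z → ℝ} {h : W → ℝ} (hu : MemLp u 2 q.lawZ) (hh : MemLp h 2 q.lawW) :
    ∫ z, u z * q.condMeanW h z ∂q.lawZ = ∫ w, h w * q.condMeanZ u w ∂q.lawW := by
  have h1 := q.swap.integral_mul_condMeanW (by rwa [mass_swap]) (by rwa [mass_swap]) h u
  rw [lawZ_swap, mass_swap] at h1
  refine (q.integral_mul_condMeanW h0 hm u h).trans (Eq.trans ?_ h1.symm)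
  rw [integral_integral_swap (f := fun z w => u z * h w * (q.r w z / q.mass).toReal)
    (q.integrable_mul_joint h0 hm hu hh).swap]
  simp only [swap, mul_comm (h _)]

/-- Completeness: the conditional expectation operator has dense range. -/
theorem ZComplete.eq_zero_of_forall_inner_eq_zero {q : PairDensity μ ν} (hc : q.ZComplete)
    (h0 : q.mass ≠ 0) (hm : q.mass ≠ ∞) {u : Lp ℝ 2 q.lawZ}
    (hu : ∀ h, inner ℝ u (q.condExpOp h) = 0) : u = 0 := by
  -- Conditional expectation given `w` also maps L² to L², so `E[u(Z) | w]` is an admissible test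
  -- function. Inserting it for `h` turns the hypothesis into `‖E[u(Z) | W]‖² = 0`.
  have hmem : MemLp (q.condMeanZ u) 2 q.lawW := by
    have := q.swap.memLp_condMeanW (Lp.stronglyMeasurable u).measurable
      (by rw [lawW_swap]; exact Lp.memLp u)
    rwa [lawZ_swap] at this
  have h1 := hu (hmem.toLp _)
  have h2 : inner ℝ u (q.condExpOp (hmem.toLp _))
      = ∫ z, u z * q.condMeanW (hmem.toLp _) z ∂q.lawZ := by
    rw [L2.inner_def]
    refine integral_congr_ae ?_
    filter_upwards [q.coeFn_condExpOp (hmem.toLp _)] with z hz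
    simp [hz, mul_comm]
  rw [h2, q.integral_condMeanW_eq_integral_condMeanZ h0 hm (Lp.memLp u) (Lp.memLp _)] at h1
  have h3 : inner ℝ (hmem.toLp _) (hmem.toLp _) = (0 : ℝ) := by
    rw [← h1, L2.inner_def]
    refine integral_congr_ae ?_
    filter_upwards [hmem.coeFn_toLp] with w hw
    simp [hw, sq]
  rw [inner_self_eq_zero] at h3
  have h4 : q.condMeanZ u =ᵐ[q.lawW] 0 := by
    have := hmem.coeFn_toLp
    rw [h3] at this
    exact this.symm.trans (Lp.coeFn_zero _ _ _)
  rw [Lp.eq_zero_iff_ae_eq_zero]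
  exact hc u (Lp.memLp u) h4

/-- Under completeness and Picard's condition, the integral equation `E[h(W) | z] = g(z)` has a
square integrable solution. -/
theorem exists_condMeanW_eq (q : PairDensity μ ν) (h0 : q.mass ≠ 0) (hm : q.mass ≠ ∞)
    (hHS : q.hilbertSchmidtIntegral ≠ ∞) (hc : q.ZComplete) {g : Z → ℝ} (hg : MemLp g 2 q.lawZ)
    (hp : q.PicardCondition g) :
    ∃ h : W → ℝ, Measurable h ∧ MemLp h 2 q.lawW ∧ ∀ᵐ z ∂q.lawZ,
      Integrable (fun w => h w * (q.condW w z).toReal) μ ∧ g z = q.condMeanW h z := by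
  obtain ⟨I, σ, ψ, φ, hs⟩ := (q.hilbertSchmidtBound_condExpOp h0 hm hHS).exists_isSingularSystem
  have hi : ∀ f : Lp ℝ 2 q.lawZ, ∫ z, g z * f z ∂q.lawZ = inner ℝ (hg.toLp g) f := fun f => by
    rw [L2.inner_def]
    refine integral_congr_ae ?_
    filter_upwards [hg.coeFn_toLp] with z hz
    simp [hz, mul_comm]
  -- `PicardCondition` speaks of all singular systems and would be vacuous if none existed; here it
  -- is used for the one constructed.
  have hsum := hp I σ ψ φ hs
  simp only [hi] at hsum
  obtain ⟨h, hh⟩ := hs.exists_apply_eq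
    (fun u hu => hc.eq_zero_of_forall_inner_eq_zero h0 hm hu) hsum
  have hmeas := (Lp.stronglyMeasurable h).measurable
  refine ⟨h, hmeas, Lp.memLp h, ?_⟩
  filter_upwards [q.ae_integrable_condW hmeas ((Lp.memLp h).integrable one_le_two),
    q.coeFn_condExpOp h, hg.coeFn_toLp] with z h1 h2 h3
  exact ⟨h1, by rw [← h3, ← hh, h2]⟩

end PairDensity

/-! ### Square integrability of the two left sides, and the two equations -/

namespace ObservedLaw

variable {Y₀ Y₁ Y₂ A₁ A₂ Z₁ Z₂ W₁ W₂ : Type*}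
  [MeasurableSpace Y₀] [MeasurableSpace Y₁] [MeasurableSpace Y₂]
  [MeasurableSpace A₁] [MeasurableSpace A₂] [MeasurableSpace Z₁] [MeasurableSpace Z₂]
  [MeasurableSpace W₁] [MeasurableSpace W₂]
  (M : ObservedLaw Y₀ Y₁ Y₂ A₁ A₂ Z₁ Z₂ W₁ W₂) (v : Values Y₀ Y₁ Y₂ A₁ A₂)

theorem measurable_condY₂ : Measurable (M.condY₂ v) := by
  refine Measurable.div ?_ (M.pair₂ v).measurable_margZ
  refine Measurable.lintegral_prod_right' (ν := M.μW₁.prod M.μW₂)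
    (f := fun p : (Z₁ × Z₂) × (W₁ × W₂) => M.f (v.y₀, v.y₁, v.y₂, v.a₁, v.a₂, p.1, p.2)) ?_
  exact M.measurable_f.comp (by fun_prop)

theorem memLp_condY₂ (h : ∫⁻ z, M.condY₂ v z ^ 2 ∂(M.pair₂ v).lawZ < ∞) :
    MemLp (fun z => (M.condY₂ v z).toReal) 2 (M.pair₂ v).lawZ := by
  refine ⟨(M.measurable_condY₂ v).ennreal_toReal.aestronglyMeasurable, ?_⟩
  rw [eLpNorm_lt_top_iff_lintegral_rpow_enorm_lt_top two_ne_zero ENNReal.ofNat_ne_top]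
  refine lt_of_le_of_lt (lintegral_mono fun z => ?_) h
  rw [ENNReal.toReal_ofNat, ENNReal.rpow_ofNat]
  gcongr
  rw [Real.enorm_eq_ofReal ENNReal.toReal_nonneg]
  -- `toReal` sends the value `∞` to `0`, so passing to real values can only decrease the integrand.
  exact ENNReal.ofReal_toReal_le

theorem measurable_densWYZ₁ (y₁ : Y₁) :
    Measurable fun p : (W₁ × W₂) × Z₁ => M.densWYZ₁ v y₁ p.1 p.2 := by
  refine Measurable.lintegral_prod_right' (ν := M.μA₂.prod (M.μZ₂.prod M.μY₂))
    (f := fun p : ((W₁ × W₂) × Z₁) × (A₂ × Z₂ × Y₂) =>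
      M.f (v.y₀, y₁, p.2.2.2, v.a₁, p.2.1, (p.1.2, p.2.2.1), p.1.1)) ?_
  exact M.measurable_f.comp (by fun_prop)

theorem measurable_densYZ₁ : Measurable (M.densYZ₁ v) :=
  (M.measurable_densWYZ₁ v v.y₁).lintegral_prod_left'

theorem measurable_target₂₁ {h : W₁ × W₂ → ℝ} (hh : Measurable h) :
    Measurable (M.target₂₁ v h) := by
  have hc : Measurable fun p : (W₁ × W₂) × Z₁ => M.condW₂ v p.1 p.2 :=
    (M.measurable_densWYZ₁ v v.y₁).div ((M.measurable_densYZ₁ v).comp measurable_snd)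
  have hi : Measurable fun p : (W₁ × W₂) × Z₁ => h p.1 * (M.condW₂ v p.1 p.2).toReal :=
    (hh.comp measurable_fst).mul hc.ennreal_toReal
  exact hi.stronglyMeasurable.integral_prod_left'.measurable.mul
    ((M.measurable_densYZ₁ v).div (M.pair₁ v).measurable_margZ).ennreal_toReal

variable {M v} in
theorem SquareIntegrableSecond.memLp {h : W₁ × W₂ → ℝ} (hs : M.SquareIntegrableSecond v h)
    (hh : Measurable h) : MemLp (M.target₂₁ v h) 2 (M.pair₁ v).lawZ := by
  refine ⟨(M.measurable_target₂₁ v hh).aestronglyMeasurable, ?_⟩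
  rw [eLpNorm_lt_top_iff_lintegral_rpow_enorm_lt_top two_ne_zero ENNReal.ofNat_ne_top]
  refine lt_of_eq_of_lt (lintegral_congr fun z => ?_) hs.2
  rw [ENNReal.toReal_ofNat, ENNReal.rpow_ofNat, Real.enorm_eq_ofReal_abs,
    ← ENNReal.ofReal_pow (abs_nonneg _), sq_abs]

end ObservedLaw

theorem lemma2 {Y₀ Y₁ Y₂ A₁ A₂ Z₁ Z₂ W₁ W₂ : Type*}
    [MeasurableSpace Y₀] [MeasurableSpace Y₁] [MeasurableSpace Y₂]
    [MeasurableSpace A₁] [MeasurableSpace A₂] [MeasurableSpace Z₁] [MeasurableSpace Z₂]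
    [MeasurableSpace W₁] [MeasurableSpace W₂]
    (M : ObservedLaw Y₀ Y₁ Y₂ A₁ A₂ Z₁ Z₂ W₁ W₂)
    (S : Set (Values Y₀ Y₁ Y₂ A₁ A₂))
    (hS : ∀ v ∈ S, M.Admissible v)
    -- the conditional expectation operators are Hilbert-Schmidt
    (hHS : ∀ v ∈ S, (M.pair₁ v).hilbertSchmidtIntegral + (M.pair₂ v).hilbertSchmidtIntegral < ∞)
    -- the left side of the first equation is square integrable
    (hL2 : ∀ v ∈ S, ∫⁻ z, M.condY₂ v z ^ 2 ∂(M.pair₂ v).lawZ < ∞)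
    -- Picard's condition for the first equation
    (hPicard : ∀ v ∈ S, (M.pair₂ v).PicardCondition fun z => (M.condY₂ v z).toReal)
    -- completeness in the `Z` variables
    (hComplete : ∀ v ∈ S, (M.pair₂ v).ZComplete ∧ (M.pair₁ v).ZComplete) :
    (∃ h₂₂ : Values Y₀ Y₁ Y₂ A₁ A₂ → W₁ × W₂ → ℝ, ∀ v ∈ S,
      M.SolvesFirst v (h₂₂ v) ∧ MemLp (h₂₂ v) 2 (M.pair₂ v).lawW) ∧
    ∀ h₂₂ : Values Y₀ Y₁ Y₂ A₁ A₂ → W₁ × W₂ → ℝ,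
      (∀ v ∈ S, M.SolvesFirst v (h₂₂ v)) →
      -- the left side of the second equation is square integrable
      (∀ v ∈ S, M.SquareIntegrableSecond v (h₂₂ v)) →
      -- Picard's condition for the second equation
      (∀ v ∈ S, (M.pair₁ v).PicardCondition (M.target₂₁ v (h₂₂ v))) →
      ∃ h₂₁ : Values Y₀ Y₁ Y₂ A₁ A₂ → W₁ → ℝ, ∀ v ∈ S,
        M.SolvesSecond v (h₂₂ v) (h₂₁ v) ∧ MemLp (h₂₁ v) 2 (M.pair₁ v).lawW := by

  refine ⟨?_, fun h₂₂ hsol hsq hpic => ?_⟩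
  · have key : ∀ v ∈ S, ∃ h : W₁ × W₂ → ℝ, M.SolvesFirst v h ∧ MemLp h 2 (M.pair₂ v).lawW := by
      intro v hv
      obtain ⟨h, hm, hL, hz⟩ := (M.pair₂ v).exists_condMeanW_eq (hS v hv).y₁a₂.1.ne'
        (hS v hv).y₁a₂.2.ne (ENNReal.add_lt_top.1 (hHS v hv)).2.ne (hComplete v hv).1
        (M.memLp_condY₂ v (hL2 v hv)) (hPicard v hv)
      exact ⟨h, ⟨hm, hz⟩, hL⟩
    -- Solutions are chosen separately at each point of `S`: nothing relates them across points, as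
    -- measurability is required in `w̄₂` only.
    choose! h hh using key
    exact ⟨h, hh⟩
  · have key : ∀ v ∈ S, ∃ h : W₁ → ℝ,
        M.SolvesSecond v (h₂₂ v) h ∧ MemLp h 2 (M.pair₁ v).lawW := by
      intro v hv
      obtain ⟨h, hm, hL, hz⟩ := (M.pair₁ v).exists_condMeanW_eq (hS v hv).y₀a₁.1.ne'
        (hS v hv).y₀a₁.2.ne (ENNReal.add_lt_top.1 (hHS v hv)).1.ne (hComplete v hv).2
        ((hsq v hv).memLp (hsol v hv).1) (hpic v hv)
      -- Absolute convergence of the left side is part of (b2); that of the right side comes with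
      -- the solution.
      exact ⟨h, ⟨hm, (hsq v hv).1.and hz⟩, hL⟩
    choose! h hh using key
    exact ⟨h, hh⟩
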